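/- Let $R$ be an associative ring with unit. An $\mathcal R$-module is a covariant additive functor from the category of (left) $R$-modules to the category of abelian groups; morphisms of $\mathcal R$-modules are natural transformations. Let $\langle\text{Qs-ch}\rangle$ be the full subcategory of the category of $\mathcal R$-modules whose objects are the $\mathcal R$-modules that preserve direct limits (colimits of direct systems indexed by upward directed sets). For a right $R$-module $M$, the quasi-coherent $\mathcal R$-module associated with $M$ is the functor $\mathcal M(S)=M\otimes_R S$. A morphism $N\to N'$ of right $R$-modules is pure if $N\otimes_R S\to N'\otimes_R S$ is injective for every $R$-module $S$, and a right $R$-module $M$ is pure-injective if for every pure morphism $N\to N'$ the induced map $\operatorname{Hom}_R(N',M)\to\operatorname{Hom}_R(N,M)$ is surjective. Proposition. Let $\mathbb M$ be an $\mathcal R$-module. Then $\mathbb M$ belongs to $\langle\text{Qs-ch}\rangle$ and is an injective object of $\langle\text{Qs-ch}\rangle$ if and only if $\mathbb M$ is isomorphic to the quasi-coherent $\mathcal R$-module associated with some pure-injective right $R$-module. -/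

import Mathlib

universe u

open CategoryTheory CategoryTheory.Limits MulOpposite
open scoped TensorProduct

noncomputable section

namespace QsCh

/-! ### Tensor products over a noncommutative ring

Right `R`-modules are modules over `Rᵐᵒᵖ`, so that `m · r` is `op r • m`. -/

section Tensor

variable (R : Type u) [Ring R]

/-- The subgroup of `M ⊗[ℤ] S` generated by all `(m · r) ⊗ s - m ⊗ (r • s)`. -/
def balancedRel (M : Type u) [AddCommGroup M] [Module Rᵐᵒᵖ M]
    (S : Type u) [AddCommGroup S] [Module R S] : Submodule ℤ (M ⊗[ℤ] S) :=
  Submodule.span ℤ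
    {x | ∃ (m : M) (r : R) (s : S), x = (op r • m) ⊗ₜ[ℤ] s - m ⊗ₜ[ℤ] (r • s)}

/-- The abelian group `M ⊗_R S`, for a right `R`-module `M` and a left `R`-module `S`. -/
abbrev RTensor (M : Type u) [AddCommGroup M] [Module Rᵐᵒᵖ M]
    (S : Type u) [AddCommGroup S] [Module R S] : Type u :=
  (M ⊗[ℤ] S) ⧸ balancedRel R M S

variable {R}
variable {M M' M'' : Type u} [AddCommGroup M] [Module Rᵐᵒᵖ M] [AddCommGroup M'] [Module Rᵐᵒᵖ M']
  [AddCommGroup M''] [Module Rᵐᵒᵖ M'']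
variable {S S' S'' : Type u} [AddCommGroup S] [Module R S] [AddCommGroup S'] [Module R S']
  [AddCommGroup S''] [Module R S'']

/-- The pure tensor `m ⊗ s` in `M ⊗_R S`. -/
def rtmul (R : Type u) [Ring R] {M : Type u} [AddCommGroup M] [Module Rᵐᵒᵖ M]
    {S : Type u} [AddCommGroup S] [Module R S] (m : M) (s : S) : RTensor R M S :=
  Submodule.Quotient.mk (m ⊗ₜ[ℤ] s)

theorem balancedRel_le_comap (f : M →ₗ[Rᵐᵒᵖ] M') (g : S →ₗ[R] S') :
    balancedRel R M S ≤ (balancedRel R M' S').comap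
      (TensorProduct.map f.toAddMonoidHom.toIntLinearMap g.toAddMonoidHom.toIntLinearMap) := by
  refine Submodule.span_le.2 ?_
  rintro _ ⟨m, r, s, rfl⟩
  refine Submodule.subset_span ⟨f m, r, g s, ?_⟩
  simp

/-- The homomorphism `f ⊗ g : M ⊗_R S → M' ⊗_R S'`. -/
def rtmap (f : M →ₗ[Rᵐᵒᵖ] M') (g : S →ₗ[R] S') : RTensor R M S →ₗ[ℤ] RTensor R M' S' :=
  (balancedRel R M S).mapQ (balancedRel R M' S')
    (TensorProduct.map f.toAddMonoidHom.toIntLinearMap g.toAddMonoidHom.toIntLinearMap)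
    (balancedRel_le_comap f g)

@[simp]
theorem rtmap_rtmul (f : M →ₗ[Rᵐᵒᵖ] M') (g : S →ₗ[R] S') (m : M) (s : S) :
    rtmap f g (rtmul R m s) = rtmul R (f m) (g s) := rfl

theorem rtensor_hom_ext {A : Type u} [AddCommGroup A] {φ ψ : RTensor R M S →ₗ[ℤ] A}
    (h : ∀ m s, φ (rtmul R m s) = ψ (rtmul R m s)) : φ = ψ := by
  refine Submodule.linearMap_qext _ (TensorProduct.ext' fun m s => h m s)

theorem rtmap_id : rtmap (LinearMap.id : M →ₗ[Rᵐᵒᵖ] M) (LinearMap.id : S →ₗ[R] S) =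
    LinearMap.id :=
  rtensor_hom_ext fun _ _ => rfl

theorem rtmap_comp (f : M →ₗ[Rᵐᵒᵖ] M') (f' : M' →ₗ[Rᵐᵒᵖ] M'') (g : S →ₗ[R] S')
    (g' : S' →ₗ[R] S'') :
    rtmap (f' ∘ₗ f) (g' ∘ₗ g) = rtmap f' g' ∘ₗ rtmap f g :=
  rtensor_hom_ext fun _ _ => rfl

theorem rtmap_add_right (f : M →ₗ[Rᵐᵒᵖ] M') (g g' : S →ₗ[R] S') :
    rtmap f (g + g') = rtmap f g + rtmap f g' :=
  rtensor_hom_ext fun m s =>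
    congrArg (Submodule.Quotient.mk) (TensorProduct.tmul_add (f m) (g s) (g' s))

end Tensor

section Functors

variable (R : Type u) [Ring R]

/-- `𝓡`-modules: additive covariant functors from left `R`-modules to abelian groups. -/
abbrev FunctorModule := ModuleCat.{u} R ⥤+ AddCommGrpCat.{u}

variable {R} in
/-- The quasi-coherent `𝓡`-module `S ↦ M ⊗_R S` associated with a right `R`-module `M`,
as a plain functor. -/
def quasiCoherentFunctor (M : ModuleCat.{u} Rᵐᵒᵖ) : ModuleCat.{u} R ⥤ AddCommGrpCat.{u} where
  obj S := AddCommGrpCat.of (RTensor R M S)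
  map g := AddCommGrpCat.ofHom (rtmap (LinearMap.id : M →ₗ[Rᵐᵒᵖ] M) g.hom).toAddMonoidHom
  map_id S := by
    ext x
    exact LinearMap.congr_fun (rtmap_id (R := R) (M := M) (S := S)) x
  map_comp g g' := by
    ext x
    exact LinearMap.congr_fun
      (rtmap_comp (LinearMap.id : M →ₗ[Rᵐᵒᵖ] M) LinearMap.id g.hom g'.hom) x

instance (M : ModuleCat.{u} Rᵐᵒᵖ) : (quasiCoherentFunctor M).Additive where
  map_add {_ _ g g'} := by
    ext x
    exact LinearMap.congr_fun (rtmap_add_right (LinearMap.id : M →ₗ[Rᵐᵒᵖ] M) g.hom g'.hom) x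

variable {R} in
/-- The quasi-coherent `𝓡`-module associated with a right `R`-module `M`. -/
def quasiCoherent (M : ModuleCat.{u} Rᵐᵒᵖ) : FunctorModule R :=
  AdditiveFunctor.of (quasiCoherentFunctor M)

/-- `F` preserves direct limits: it preserves colimits indexed by (nonempty, upward) directed
sets. -/
def PreservesDirectLimits : ObjectProperty (FunctorModule R) := fun F =>
  ∀ (I : Type u) [Preorder I] [IsDirectedOrder I] [Nonempty I], PreservesColimitsOfShape I F.obj

/-- The full subcategory of `𝓡`-modules whose objects preserve direct limits. -/
abbrev DirectLimitFunctor := (PreservesDirectLimits R).FullSubcategory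

end Functors

section Pure

variable {R : Type u} [Ring R]

/-- A morphism `f : N → N'` of right `R`-modules is pure if `f ⊗ S : N ⊗_R S → N' ⊗_R S` is
injective for every left `R`-module `S`. -/
def IsPure {N N' : ModuleCat.{u} Rᵐᵒᵖ} (f : N ⟶ N') : Prop :=
  ∀ S : ModuleCat.{u} R,
    Function.Injective (rtmap (R := R) f.hom (LinearMap.id : S →ₗ[R] S))

/-- A right `R`-module `M` is pure-injective if `Hom(N', M) → Hom(N, M)` is surjective for every
pure morphism `N → N'`. -/
def IsPureInjective (M : ModuleCat.{u} Rᵐᵒᵖ) : Prop :=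
  ∀ ⦃N N' : ModuleCat.{u} Rᵐᵒᵖ⦄ (f : N ⟶ N'), IsPure f →
    Function.Surjective fun h : N' ⟶ M => f ≫ h

end Pure

end QsCh

end

/-! For a left `R`-module `N` and an injective abelian group `E`, put `P = Hom_ℤ(N, E)`. The natural
map `P ⊗_R S → Hom_ℤ(Hom_R(S, N), E)` is bijective for `S = R`, hence for every finitely presented
`S`, as both sides are right exact in `S`. A functor `X` preserving direct limits is the left Kan
extension of its restriction to finitely presented modules, so morphisms `X → P ⊗_R -` are the same
as morphisms `X → Hom_ℤ(Hom_R(-, N), E)`, that is, by Yoneda, as homomorphisms `X(N) → E`. Extending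
the latter along monomorphisms shows that `P ⊗_R -` is injective. If `N` has every finitely
presented module as a direct summand and `X(N) ⊆ E`, then the morphism corresponding to this
inclusion is a monomorphism `X → P ⊗_R -`, so the injective objects are the retracts of these
functors `P ⊗_R -`. Finally `M ↦ M ⊗_R -` is fully faithful and turns precisely the pure morphisms
into monomorphisms, so its image is closed under retracts and `M ⊗_R -` is injective if and only if
`M` is pure-injective. -/

noncomputable section

namespace QsCh

section FilteredColimits

theorem preservesFilteredColimitsOfSize_of_isDirectedOrder {C D : Type*} [Category* C]
    [Category* D] (F : C ⥤ D)
    (h : ∀ (I : Type u) [Preorder I] [IsDirectedOrder I] [Nonempty I],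
      PreservesColimitsOfShape I F) :
    PreservesFilteredColimitsOfSize.{u, u} F where
  preserves_filtered_colimits J _ _ := by
    obtain ⟨I, _, _, _, p, _⟩ := IsFiltered.exists_directed J
    have := h I
    exact Functor.Final.preservesColimitsOfShape_of_final p F

theorem isLeftKanExtension_id_of_preservesFilteredColimits {C D E : Type*} [Category* C]
    [Category* D] [Category* E] (L : C ⥤ D) [L.IsDense] [EssentiallySmall.{u} C]
    [LocallySmall.{u} D] [∀ d, IsFiltered (CostructuredArrow L d)] (G : D ⥤ E)
    [PreservesFilteredColimitsOfSize.{u, u} G] :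
    G.IsLeftKanExtension (𝟙 (L ⋙ G)) := by
  let ext : L.LeftExtension (L ⋙ G) := .mk G (𝟙 (L ⋙ G))
  suffices pointwise : ext.IsPointwiseLeftKanExtension from pointwise.isLeftKanExtension
  intro d
  have := finallySmall_of_essentiallySmall.{u} (CostructuredArrow L d)
  have := FinallySmall.preservesColimitsOfShape_of_isFiltered.{u} (CostructuredArrow L d) G
  refine (isColimitOfPreserves G (L.denseAt d)).ofIsoColimit (Cocone.ext (Iso.refl _) fun j => ?_)
  change G.map (𝟙 _ ≫ j.hom) ≫ 𝟙 _ = 𝟙 _ ≫ G.map j.hom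
  simp

theorem bijective_comp_of_isIso_whiskerLeft {C D E : Type*} [Category* C] [Category* D]
    [Category* E] (L : C ⥤ D) (G : D ⥤ E) [G.IsLeftKanExtension (𝟙 (L ⋙ G))] {H K : D ⥤ E}
    (θ : H ⟶ K) [IsIso (L.whiskerLeft θ)] :
    Function.Bijective fun φ : G ⟶ H => φ ≫ θ := by
  have restrict (K : D ⥤ E) := (G.homEquivOfIsLeftKanExtension (𝟙 (L ⋙ G)) K).bijective
  refine (Function.Bijective.of_comp_iff' (restrict K) _).1 ?_
  convert (asIso (L.whiskerLeft θ)).homToEquiv.bijective.comp (restrict H) using 2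
  cat_disch

theorem isClosedUnderColimitsOfShape_isIso_app {C E : Type*} [Category* C] [Category* E]
    {G H : C ⥤ E} (J : Type*) [Category* J] [PreservesColimitsOfShape J G]
    [PreservesColimitsOfShape J H] (θ : G ⟶ H) :
    ObjectProperty.IsClosedUnderColimitsOfShape (fun X => IsIso (θ.app X)) J where
  colimitsOfShape_le := by
    rintro X ⟨p⟩
    have (j : J) : IsIso ((p.diag.whiskerLeft θ).app j) := p.prop_diag_obj j
    have := NatIso.isIso_of_isIso_app (p.diag.whiskerLeft θ)
    let e := IsColimit.coconePointsIsoOfNatIso (isColimitOfPreserves G p.isColimit)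
      (isColimitOfPreserves H p.isColimit) (asIso (p.diag.whiskerLeft θ))
    suffices θ.app X = e.hom by
      simp only [this]
      infer_instance
    refine (isColimitOfPreserves G p.isColimit).hom_ext fun j => ?_
    exact (θ.naturality _).trans
      ((isColimitOfPreserves G p.isColimit).ι_map (H.mapCocone _) (p.diag.whiskerLeft θ) j).symm

attribute [local instance] Cardinal.fact_isRegular_aleph0

theorem mono_app_of_mono_app_isFinitelyPresentable {C E : Type*} [Category.{u} C] [Category* E]
    [HasFilteredColimitsOfSize.{u, u} E] [AB5OfSize.{u, u} E] [IsFinitelyAccessibleCategory.{u} C]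
    {G H : C ⥤ E} [PreservesFilteredColimitsOfSize.{u, u} G]
    [PreservesFilteredColimitsOfSize.{u, u} H] (f : G ⟶ H)
    (hf : ∀ X, IsFinitelyPresentable.{u} X → Mono (f.app X)) (X : C) :
    Mono (f.app X) := by
  obtain ⟨J, _, _, ⟨p⟩⟩ := (isCardinalFilteredGenerator_isCardinalPresentable C
    Cardinal.aleph0.{u}).exists_colimitsOfShape X
  have : IsFiltered J := isFiltered_of_isCardinalFiltered J Cardinal.aleph0.{u}
  have := PreservesFilteredColimitsOfSize.preserves_filtered_colimits (F := G) J
  have := PreservesFilteredColimitsOfSize.preserves_filtered_colimits (F := H) J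
  have (j : J) : Mono ((p.diag.whiskerLeft f).app j) := hf _ (p.prop_diag_obj j)
  have := NatTrans.mono_of_mono_app (p.diag.whiskerLeft f)
  exact colim.map_mono' (p.diag.whiskerLeft f) (isColimitOfPreserves G p.isColimit)
    (isColimitOfPreserves H p.isColimit) _ (by simp)

end FilteredColimits

section Retracts

theorem exists_forall_isSplitMono {C : Type*} [Category* C] [HasZeroMorphisms C]
    [HasCoproducts.{u} C] (P : ObjectProperty C) [ObjectProperty.EssentiallySmall.{u} P] :
    ∃ N, ∀ B, P B → ∃ i : B ⟶ N, IsSplitMono i := by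
  obtain ⟨Q, _, -, P_le⟩ := ObjectProperty.EssentiallySmall.exists_small_le.{u} P
  let f (B : Shrink.{u} (Subtype Q)) : C := ((equivShrink _).symm B).1
  refine ⟨∐ f, fun B hB => ?_⟩
  obtain ⟨B', hB', ⟨e⟩⟩ := P_le B hB
  let e' : B ≅ f (equivShrink _ ⟨B', hB'⟩) := e ≪≫ eqToIso (by simp [f])
  exact ⟨e'.hom ≫ Sigma.ι f _, inferInstance⟩

theorem mono_app_of_isSplitMono {C E : Type*} [Category* C] [Category* E] {G H : C ⥤ E}
    (f : G ⟶ H) {B N : C} (i : B ⟶ N) [IsSplitMono i] [Mono (f.app N)] : Mono (f.app B) :=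
  mono_of_mono_fac (f.naturality i).symm

instance isStableUnderRetracts_essImage {C D : Type*} [Category* C] [Category* D]
    [IsIdempotentComplete C] (Q : C ⥤ D) [Q.Full] [Q.Faithful] :
    Q.essImage.IsStableUnderRetracts where
  of_retract := by
    rintro F F' h ⟨P, ⟨e⟩⟩
    let h' : Retract F (Q.obj P) := h.trans (Retract.ofIso e.symm)
    obtain ⟨p, hp⟩ := Q.map_surjective (h'.r ≫ h'.i)
    obtain ⟨M, i, r, i_r, r_i⟩ := IsIdempotentComplete.idempotents_split P p
      (Q.map_injective (by simp [hp]))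
    have map_r_i : Q.map r ≫ Q.map i = h'.r ≫ h'.i := by rw [← Q.map_comp, r_i, hp]
    have map_i_r : Q.map i ≫ Q.map r = 𝟙 _ := by rw [← Q.map_comp, i_r, Q.map_id]
    exact ⟨M, ⟨⟨Q.map i ≫ h'.r, h'.i ≫ Q.map r, by simp [← reassoc_of% map_r_i, map_i_r],
      by simp [reassoc_of% map_r_i]⟩⟩⟩

end Retracts

section FinitelyPresented

theorem isStrongGenerator_of_isSeparating {C : Type*} [Category* C] [Balanced C]
    {P : ObjectProperty C} (hP : P.IsSeparating) : P.IsStrongGenerator :=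
  ObjectProperty.isStrongGenerator_iff.2
    ⟨hP, fun _ _ i _ h => (hP.isDetecting.isIso_iff_of_mono i).2 h⟩

variable (R : Type u) [Ring R]

theorem isSeparator_self : IsSeparator (ModuleCat.of R R) := fun M N f g h => by
  ext m
  simpa using ConcreteCategory.congr_hom
    (h _ (by simp) (ModuleCat.ofHom (LinearMap.toSpanSingleton R M m))) (1 : R)

/-- The functor corepresented by `R` is the forgetful functor: a homomorphism `R → M` amounts to
the image of `1`. -/
def coyonedaSelfIso : coyoneda.obj (.op (ModuleCat.of R R)) ≅ forget (ModuleCat.{u} R) :=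
  NatIso.ofComponents fun M =>
    (ModuleCat.homEquiv.trans (LinearMap.ringLmapEquivSelf R ℤ M).toEquiv).toIso

instance isFinitelyPresentable_self : IsFinitelyPresentable.{u} (ModuleCat.of R R) := by
  rw [isFinitelyPresentable_iff_preservesFilteredColimits]
  exact ⟨fun J _ _ => preservesColimitsOfShape_of_natIso (coyonedaSelfIso R).symm⟩

attribute [local instance] Cardinal.fact_isRegular_aleph0

theorem singleton_self_le_isCardinalPresentable :
    .singleton (ModuleCat.of R R) ≤ isCardinalPresentable (ModuleCat.{u} R) Cardinal.aleph0.{u} :=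
  ObjectProperty.singleton_le_iff.2 (isFinitelyPresentable_self R)

instance : IsLocallyFinitelyPresentable.{u} (ModuleCat.{u} R) :=
  (IsCardinalLocallyPresentable.iff_exists_isStrongGenerator _ _).2
    ⟨_, inferInstance, isStrongGenerator_of_isSeparating (isSeparator_self R),
      singleton_self_le_isCardinalPresentable R⟩

variable {R}

theorem isFinitelyPresentable_le_of_isClosedUnderFiniteColimits
    {Q : ObjectProperty (ModuleCat.{u} R)} [Q.IsClosedUnderIsomorphisms]
    (hQ : ∀ (J : Type u) [SmallCategory J] [FinCategory J], Q.IsClosedUnderColimitsOfShape J)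
    (self : Q (ModuleCat.of R R)) :
    ObjectProperty.isFinitelyPresentable.{u} (ModuleCat.{u} R) ≤ Q := by
  rw [ObjectProperty.isFinitelyPresentable_eq_isCardinalPresentable,
    IsStrongGenerator.colimitsCardinalClosure_eq_isCardinalPresentable
      (isStrongGenerator_of_isSeparating (isSeparator_self R))
      (singleton_self_le_isCardinalPresentable R)]
  refine ObjectProperty.colimitsCardinalClosure_le _ _ (fun J _ hJ => ?_) ?_
  · obtain ⟨_⟩ := (Arrow.finite_iff J).1 ((hasCardinalLT_aleph0_iff _).1 hJ)
    exact hQ J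
  · simpa only [ObjectProperty.singleton_le_iff]

end FinitelyPresented

section AdditiveYoneda

variable {C : Type*} [Category.{u} C] [Preadditive C]

/-- The natural transformation `Hom(B, -) ⟶ G` corresponding to `x : G(B)` under the additive
Yoneda lemma. -/
def coyonedaLift {B : C} (G : C ⥤ AddCommGrpCat.{u}) [G.Additive] (x : G.obj B) :
    preadditiveCoyoneda.obj (.op B) ⟶ G where
  app S := AddCommGrpCat.ofHom <| (AddMonoidHom.eval x).comp <|
    AddCommGrpCat.homAddEquiv.toAddMonoidHom.comp (G.mapAddHom (X := B) (Y := S))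
  naturality S S' f := by
    ext g
    exact ConcreteCategory.congr_hom (G.map_comp g f) x

theorem coyonedaLift_app_id {B : C} (G : C ⥤ AddCommGrpCat.{u}) [G.Additive] (x : G.obj B) :
    (coyonedaLift G x).app B (𝟙 B) = x :=
  ConcreteCategory.congr_hom (G.map_id B) x

theorem coyonedaLift_comp {B : C} {G H : C ⥤ AddCommGrpCat.{u}} [G.Additive] [H.Additive]
    (f : G ⟶ H) (x : G.obj B) :
    coyonedaLift G x ≫ f = coyonedaLift H (f.app B x) := by
  ext S g
  exact ConcreteCategory.congr_hom (f.naturality g) x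

instance {B : C} [IsFinitelyPresentable.{u} B] :
    PreservesFilteredColimitsOfSize.{u, u} (preadditiveCoyoneda.obj (.op B)) where
  preserves_filtered_colimits J _ _ := by
    have : PreservesColimitsOfShape J (preadditiveCoyoneda.obj (.op B) ⋙ forget _) :=
      inferInstanceAs (PreservesColimitsOfShape J (coyoneda.obj (.op B)))
    have : ReflectsColimitsOfShape J (forget AddCommGrpCat.{u}) :=
      reflectsColimitsOfShape_of_reflectsIsomorphisms
    exact preservesColimitsOfShape_of_reflects_of_preserves _ (forget _)

/-- The functor `S ↦ Hom(Hom(S, N), E)`. -/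
def biduality (N : C) (E : AddCommGrpCat.{u}) : C ⥤ AddCommGrpCat.{u} :=
  (preadditiveYoneda.obj N).rightOp ⋙ preadditiveYoneda.obj E

/-- Evaluation at the identity, `Hom(Hom(N, N), E) → E`. -/
def bidualityEval (N : C) (E : AddCommGrpCat.{u}) : (biduality N E).obj N ⟶ E :=
  AddCommGrpCat.ofHom <| (AddMonoidHom.eval (𝟙 N)).comp <|
    (AddCommGrpCat.homAddEquiv (M := .of (N ⟶ N)) (N := E)).toAddMonoidHom

/-- The natural transformation `G ⟶ Hom(Hom(-, N), E)` corresponding to `φ : G(N) → E`, namely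
`x ↦ (u ↦ φ (G(u) x))`. -/
def toBiduality {G : C ⥤ AddCommGrpCat.{u}} [G.Additive] {N : C} {E : AddCommGrpCat.{u}}
    (φ : G.obj N ⟶ E) : G ⟶ biduality N E where
  app S := AddCommGrpCat.ofHom <| AddMonoidHom.mk'
    (fun x => AddCommGrpCat.ofHom <| φ.hom.comp <| (AddMonoidHom.eval x).comp <|
      AddCommGrpCat.homAddEquiv.toAddMonoidHom.comp (G.mapAddHom (X := S) (Y := N)))
    fun x y => AddCommGrpCat.hom_ext (AddMonoidHom.ext fun u => map_add (G.map u ≫ φ).hom x y)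
  naturality S S' f := by
    ext x
    refine AddCommGrpCat.hom_ext (AddMonoidHom.ext fun u => ?_)
    exact congrArg φ (ConcreteCategory.congr_hom (G.map_comp f u) x).symm

theorem toBiduality_app_comp_bidualityEval {G : C ⥤ AddCommGrpCat.{u}} [G.Additive] {N : C}
    {E : AddCommGrpCat.{u}} (φ : G.obj N ⟶ E) :
    (toBiduality φ).app N ≫ bidualityEval N E = φ := by
  ext x
  exact congrArg φ (ConcreteCategory.congr_hom (G.map_id N) x)

theorem bijective_app_comp_bidualityEval {G : C ⥤ AddCommGrpCat.{u}} [G.Additive] {N : C}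
    {E : AddCommGrpCat.{u}} :
    Function.Bijective fun ψ : G ⟶ biduality N E => ψ.app N ≫ bidualityEval N E := by
  refine Function.bijective_iff_has_inverse.2
    ⟨toBiduality, fun ψ => ?_, toBiduality_app_comp_bidualityEval⟩
  ext S x
  refine AddCommGrpCat.hom_ext (AddMonoidHom.ext fun u => ?_)
  have natural := ConcreteCategory.congr_hom (ψ.naturality u) x
  exact (congrArg (fun χ : (biduality N E).obj N => χ.hom (𝟙 N)) natural).trans
    (congrArg (ψ.app S x).hom (Category.comp_id u))

instance (N : C) (E : AddCommGrpCat.{u}) [Injective E] :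
    PreservesFiniteColimits (biduality N E) := by
  have : PreservesFiniteColimits (preadditiveYoneda.obj N).rightOp :=
    preservesFiniteColimits_rightOp _
  have : PreservesFiniteColimits (preadditiveYoneda.obj E) :=
    comp_preservesFiniteColimits (preadditiveYonedaObj E) (forget₂ _ AddCommGrpCat.{u})
  exact comp_preservesFiniteColimits _ _

end AdditiveYoneda

section TensorProduct

variable {R : Type u} [Ring R] {M : Type u} [AddCommGroup M] [Module Rᵐᵒᵖ M]
  {S : Type u} [AddCommGroup S] [Module R S]

theorem rtmul_add (m : M) (s s' : S) : rtmul R m (s + s') = rtmul R m s + rtmul R m s' :=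
  congrArg Submodule.Quotient.mk (TensorProduct.tmul_add m s s')

theorem add_rtmul (m m' : M) (s : S) : rtmul R (m + m') s = rtmul R m s + rtmul R m' s :=
  congrArg Submodule.Quotient.mk (TensorProduct.add_tmul m m' s)

theorem op_smul_rtmul (r : R) (m : M) (s : S) : rtmul R (op r • m) s = rtmul R m (r • s) :=
  (Submodule.Quotient.eq _).2 (Submodule.subset_span ⟨m, r, s, rfl⟩)

/-- The homomorphism out of `M ⊗_R S` induced by a balanced biadditive map. -/
def rtlift {A : Type u} [AddCommGroup A] (β : M →+ S →+ A)
    (balanced : ∀ (r : R) m s, β (op r • m) s = β m (r • s)) : RTensor R M S →ₗ[ℤ] A :=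
  (balancedRel R M S).liftQ
    (TensorProduct.liftAddHom β fun n m s => by simp).toIntLinearMap <| by
      refine Submodule.span_le.2 ?_
      rintro _ ⟨m, r, s, rfl⟩
      simp [balanced]

theorem exists_eq_rtmul_one (x : RTensor R M R) : ∃ m : M, x = rtmul R m 1 := by
  obtain ⟨t, rfl⟩ := Submodule.Quotient.mk_surjective _ x
  induction t with
  | zero => exact ⟨0, by simp [rtmul]⟩
  | tmul m r => exact ⟨op r • m, by rw [op_smul_rtmul, smul_eq_mul, mul_one]; rfl⟩
  | add t t' ht ht' =>
    obtain ⟨m, hm⟩ := ht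
    obtain ⟨m', hm'⟩ := ht'
    exact ⟨m + m', by rw [add_rtmul, ← hm, ← hm']; rfl⟩

variable (R) in
theorem rtmul_one_injective : Function.Injective fun m : M => rtmul R m (1 : R) := by
  let action : M →+ R →+ M :=
    ((smulAddHom Rᵐᵒᵖ M).comp (opAddEquiv : R ≃+ Rᵐᵒᵖ).toAddMonoidHom).flip
  let contract : RTensor R M R →ₗ[ℤ] M :=
    rtlift action fun r m s => (mul_smul (op s) (op r) m).symm
  exact Function.LeftInverse.injective (g := contract) fun m => one_smul Rᵐᵒᵖ m

theorem quasiCoherentFunctor_obj_hom_ext {M : ModuleCat.{u} Rᵐᵒᵖ} {S : ModuleCat.{u} R}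
    {A : AddCommGrpCat.{u}} {f g : (quasiCoherentFunctor M).obj S ⟶ A}
    (h : ∀ (m : M) (s : S), f (rtmul R m s) = g (rtmul R m s)) : f = g :=
  AddCommGrpCat.hom_ext (AddMonoidHom.toIntLinearMap_injective (rtensor_hom_ext h))

end TensorProduct

section TensorHomAdjunction

/-- The right `A`-module `Hom_ℤ(N, E)` for a left `A`-module `N`, where `φ · a` is `φ` precomposed
with the action of `a`. -/
def homModule {A : Type u} [Ring A] (N : ModuleCat.{u} A) (E : AddCommGrpCat.{u}) :
    ModuleCat.{u} Aᵐᵒᵖ :=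
  @ModuleCat.of Aᵐᵒᵖ _ (N →+ E) _ (inferInstanceAs (Module Aᵈᵐᵃ (N →+ E)))

variable {R : Type u} [Ring R] (M : ModuleCat.{u} Rᵐᵒᵖ)

/-- The left `R`-module `Hom_ℤ(M, A)` for a right `R`-module `M`: this is `homModule` over `Rᵐᵒᵖ`,
with scalars restricted along `R ≃ Rᵐᵒᵖᵐᵒᵖ`. -/
def leftHomModule (A : AddCommGrpCat.{u}) : ModuleCat.{u} R :=
  (ModuleCat.restrictScalars (RingEquiv.opOp R).toRingHom).obj (homModule M A)

/-- The tensor-hom adjunction `Hom_ℤ(M ⊗_R S, A) ≃ Hom_R(S, Hom_ℤ(M, A))`. -/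
def tensorHomEquiv (S : ModuleCat.{u} R) (A : AddCommGrpCat.{u}) :
    ((quasiCoherentFunctor M).obj S ⟶ A) ≃ (S ⟶ leftHomModule M A) where
  toFun f := ModuleCat.ofHom (Y := leftHomModule M A)
    { toFun s := f.hom.comp (.mk' (fun m : M => rtmul R m s) fun m m' => add_rtmul m m' s)
      map_add' s s' := AddMonoidHom.ext fun m =>
        (congrArg f (rtmul_add m s s')).trans (map_add f.hom _ _)
      map_smul' r s := AddMonoidHom.ext fun m => congrArg f (op_smul_rtmul r m s).symm }
  invFun g := AddCommGrpCat.ofHom (rtlift (AddMonoidHom.flip (g.hom.toAddMonoidHom : S →+ M →+ A))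
    fun r m s => (DFunLike.congr_fun (F := M →+ A) (g.hom.map_smul r s) m).symm).toAddMonoidHom
  left_inv _ := quasiCoherentFunctor_obj_hom_ext fun _ _ => rfl
  right_inv _ := rfl

instance : (quasiCoherentFunctor M).IsLeftAdjoint :=
  (Adjunction.adjunctionOfEquivRight (F := quasiCoherentFunctor M) (tensorHomEquiv M)
    fun _ _ _ _ _ => rfl).isLeftAdjoint

theorem quasiCoherent_preservesDirectLimits : PreservesDirectLimits R (quasiCoherent M) :=
  fun _ _ _ _ => inferInstanceAs (PreservesColimitsOfShape _ (quasiCoherentFunctor M))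

end TensorHomAdjunction

section HomModule

variable {R : Type u} [Ring R] (N : ModuleCat.{u} R) (E : AddCommGrpCat.{u})

/-- The evaluation `Hom_ℤ(N, E) ⊗_R N → E`. -/
def homModuleEval : (quasiCoherentFunctor (homModule N E)).obj N ⟶ E :=
  AddCommGrpCat.ofHom (rtlift (M := homModule N E) (AddMonoidHom.id (N →+ E))
    fun _ _ _ => rfl).toAddMonoidHom

/-- The comparison `Hom_ℤ(N, E) ⊗_R S → Hom_ℤ(Hom_R(S, N), E)`, sending `φ ⊗ s` to
`u ↦ φ (u s)`. -/
abbrev homModuleToBiduality : quasiCoherentFunctor (homModule N E) ⟶ biduality N E :=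
  toBiduality (homModuleEval N E)

theorem bijective_homModuleToBiduality_app_self :
    Function.Bijective ((homModuleToBiduality N E).app (ModuleCat.of R R)) := by
  let e : N ≃+ (ModuleCat.of R R ⟶ N) :=
    (LinearMap.ringLmapEquivSelf R ℤ N).symm.toAddEquiv.trans
      (ModuleCat.homAddEquiv (M := .of R R)).symm
  have e_one (n : N) : e n (1 : R) = n := one_smul R n
  have e_self (u : ModuleCat.of R R ⟶ N) : e (u (1 : R)) = u := e.apply_symm_apply u
  let eval (χ : (biduality N E).obj (ModuleCat.of R R)) : (ModuleCat.of R R ⟶ N) →+ E :=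
    AddCommGrpCat.Hom.hom χ
  refine Function.bijective_iff_has_inverse.2
    ⟨fun χ => rtmul R (M := homModule N E) ((eval χ).comp e.toAddMonoidHom) (1 : R), fun x => ?_,
      fun χ => ?_⟩
  · obtain ⟨φ, rfl⟩ := exists_eq_rtmul_one x
    refine congrArg (fun φ : homModule N E => rtmul R φ (1 : R)) (AddMonoidHom.ext fun n => ?_)
    exact congrArg (show N →+ E from φ) (e_one n)
  · refine AddCommGrpCat.hom_ext (AddMonoidHom.ext fun u => ?_)
    exact (congrArg (eval χ) (e_self u) :)

variable [Injective E]

instance isIso_whiskerLeft_homModuleToBiduality :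
    IsIso ((ObjectProperty.isFinitelyPresentable.{u} (ModuleCat.{u} R)).ι.whiskerLeft
      (homModuleToBiduality N E)) := by
  let Q : ObjectProperty (ModuleCat.{u} R) := fun S => IsIso ((homModuleToBiduality N E).app S)
  have : Q.IsClosedUnderIsomorphisms :=
    ⟨fun e h => (NatTrans.isIso_app_iff_of_iso (homModuleToBiduality N E) e).1 h⟩
  have self : Q (ModuleCat.of R R) :=
    (ConcreteCategory.isIso_iff_bijective _).2 (bijective_homModuleToBiduality_app_self N E)
  have fp_le : ObjectProperty.isFinitelyPresentable.{u} (ModuleCat.{u} R) ≤ Q :=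
    isFinitelyPresentable_le_of_isClosedUnderFiniteColimits
      (fun J _ _ => isClosedUnderColimitsOfShape_isIso_app J (homModuleToBiduality N E)) self
  have app (S) : IsIso (((ObjectProperty.isFinitelyPresentable.{u} (ModuleCat.{u} R)).ι.whiskerLeft
      (homModuleToBiduality N E)).app S) := fp_le _ S.property
  exact NatIso.isIso_of_isIso_app _

theorem bijective_app_comp_homModuleEval (G : ModuleCat.{u} R ⥤ AddCommGrpCat.{u}) [G.Additive]
    [PreservesFilteredColimitsOfSize.{u, u} G] :
    Function.Bijective fun g : G ⟶ quasiCoherentFunctor (homModule N E) =>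
      g.app N ≫ homModuleEval N E := by
  let L := (ObjectProperty.isFinitelyPresentable.{u} (ModuleCat.{u} R)).ι
  have : G.IsLeftKanExtension (𝟙 (L ⋙ G)) :=
    isLeftKanExtension_id_of_preservesFilteredColimits L G
  convert bijective_app_comp_bidualityEval.comp
    (bijective_comp_of_isIso_whiskerLeft L G (homModuleToBiduality N E)) using 2 with g
  simp [toBiduality_app_comp_bidualityEval]

end HomModule

section Monomorphisms

variable {R : Type u} [Ring R]

instance (F : DirectLimitFunctor R) : PreservesFilteredColimitsOfSize.{u, u} F.obj.obj :=
  preservesFilteredColimitsOfSize_of_isDirectedOrder _ F.property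

instance : (PreservesDirectLimits R).IsClosedUnderIsomorphisms where
  of_iso {F _} e h I _ _ _ :=
    have : PreservesColimitsOfShape I ((AdditiveFunctor.forget _ _).obj F) := h I
    preservesColimitsOfShape_of_natIso ((AdditiveFunctor.forget _ _).mapIso e)

theorem mono_app_of_isFinitelyPresentable {F G : DirectLimitFunctor R} (f : F ⟶ G) [Mono f]
    (B : ModuleCat.{u} R) [IsFinitelyPresentable.{u} B] : Mono (f.hom.hom.app B) := by
  let H : DirectLimitFunctor R :=
    ⟨.of (preadditiveCoyoneda.obj (.op B)), fun I _ _ _ =>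
      inferInstanceAs (PreservesColimitsOfShape I (preadditiveCoyoneda.obj (.op B)))⟩
  let lift (x : F.obj.obj.obj B) : H ⟶ F := ⟨⟨coyonedaLift F.obj.obj x⟩⟩
  refine ConcreteCategory.mono_of_injective _ fun x y hxy => ?_
  have lift_comp : lift x ≫ f = lift y ≫ f := by
    ext1; ext1
    exact (coyonedaLift_comp f.hom.hom x).trans
      ((congrArg _ hxy).trans (coyonedaLift_comp f.hom.hom y).symm)
  rw [← coyonedaLift_app_id F.obj.obj x, ← coyonedaLift_app_id F.obj.obj y]
  exact congrArg (fun g : H ⟶ F => g.hom.hom.app B (𝟙 B)) ((cancel_mono f).1 lift_comp)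

theorem mono_iff_mono_app {F G : DirectLimitFunctor R} (f : F ⟶ G) :
    Mono f ↔ ∀ S, Mono (f.hom.hom.app S) :=
  ⟨fun _ => mono_app_of_mono_app_isFinitelyPresentable f.hom.hom
      fun B _ => mono_app_of_isFinitelyPresentable f B,
    fun _ => ((PreservesDirectLimits R).ι ⋙ AdditiveFunctor.forget _ _).mono_of_mono_map
      (NatTrans.mono_of_mono_app f.hom.hom)⟩

variable (R) in
theorem exists_forall_mono_of_mono_app :
    ∃ N : ModuleCat.{u} R,
      ∀ ⦃F G : DirectLimitFunctor R⦄ (f : F ⟶ G), Mono (f.hom.hom.app N) → Mono f := by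
  obtain ⟨N, hN⟩ := exists_forall_isSplitMono.{u}
    (ObjectProperty.isFinitelyPresentable.{u} (ModuleCat.{u} R))
  refine ⟨N, fun F G f _ => (mono_iff_mono_app f).2 <|
    mono_app_of_mono_app_isFinitelyPresentable f.hom.hom fun B hB => ?_⟩
  obtain ⟨i, _⟩ := hN B hB
  exact mono_app_of_isSplitMono f.hom.hom i

end Monomorphisms

section Embedding

variable {R : Type u} [Ring R]

/-- The morphism of functors `f ⊗_R - : M ⊗_R - ⟶ M' ⊗_R -` induced by `f : M ⟶ M'`. -/
def quasiCoherentMap {M M' : ModuleCat.{u} Rᵐᵒᵖ} (f : M ⟶ M') :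
    quasiCoherentFunctor M ⟶ quasiCoherentFunctor M' where
  app S := AddCommGrpCat.ofHom (rtmap f.hom (LinearMap.id : S →ₗ[R] S)).toAddMonoidHom
  naturality _ _ _ := quasiCoherentFunctor_obj_hom_ext fun _ _ => rfl

variable (R) in
/-- The functor `M ↦ M ⊗_R -` from right `R`-modules to `𝓡`-modules preserving direct limits. -/
def quasiCoherentEmbedding : ModuleCat.{u} Rᵐᵒᵖ ⥤ DirectLimitFunctor R where
  obj M := ⟨quasiCoherent M, quasiCoherent_preservesDirectLimits M⟩
  map f := ⟨⟨quasiCoherentMap f⟩⟩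
  map_id M := by
    ext S : 4
    exact quasiCoherentFunctor_obj_hom_ext fun _ _ => rfl
  map_comp f g := by
    ext S : 4
    exact quasiCoherentFunctor_obj_hom_ext fun _ _ => rfl

instance : (quasiCoherentEmbedding R).Faithful where
  map_injective {M M'} f f' h := by
    ext m
    exact rtmul_one_injective R
      (congrArg (fun g => g.hom.hom.app (ModuleCat.of R R) (rtmul R m (1 : R))) h)

theorem exists_app_rtmul {M M' : ModuleCat.{u} Rᵐᵒᵖ}
    (g : quasiCoherentFunctor M ⟶ quasiCoherentFunctor M') (m : M) :
    ∃ m' : M', ∀ (S : ModuleCat.{u} R) (s : S), g.app S (rtmul R m s) = rtmul R m' s := by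
  obtain ⟨m', hm'⟩ := exists_eq_rtmul_one (g.app (ModuleCat.of R R) (rtmul R m (1 : R)))
  refine ⟨m', fun S s => ?_⟩
  let σ : ModuleCat.of R R ⟶ S := ModuleCat.ofHom (LinearMap.toSpanSingleton R S s)
  have σ_one : σ (1 : R) = s := one_smul R s
  have at_one : g.app S (rtmul R m (σ (1 : R))) = rtmul R m' (σ (1 : R)) :=
    (ConcreteCategory.congr_hom (g.naturality σ) (rtmul R m (1 : R))).trans
      (congrArg ((quasiCoherentFunctor M').map σ) hm')
  rwa [σ_one] at at_one

instance : (quasiCoherentEmbedding R).Full where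
  map_surjective {M M'} g := by
    choose f hf using exists_app_rtmul g.hom.hom
    have rtmul_one_inj {m m' : M'} : rtmul R m (1 : R) = rtmul R m' 1 → m = m' :=
      fun h => rtmul_one_injective R h
    let linear : M →ₗ[Rᵐᵒᵖ] M' :=
      { toFun := f
        map_add' m m' := rtmul_one_inj <| by
          rw [add_rtmul, ← hf _ (.of R R), ← hf _ (.of R R), ← hf _ (.of R R), add_rtmul]
          exact map_add (g.hom.hom.app (.of R R)).hom _ _
        map_smul' r m := rtmul_one_inj <| by
          rw [← op_unop r, RingHom.id_apply, op_smul_rtmul, ← hf _ (.of R R), ← hf _ (.of R R),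
            op_smul_rtmul] }
    refine ⟨ModuleCat.ofHom linear, ?_⟩
    ext S : 4
    exact quasiCoherentFunctor_obj_hom_ext fun m s => (hf m S s).symm

theorem isPure_iff_mono {M M' : ModuleCat.{u} Rᵐᵒᵖ} (f : M ⟶ M') :
    IsPure f ↔ Mono ((quasiCoherentEmbedding R).map f) := by
  rw [mono_iff_mono_app]
  exact forall_congr' fun S =>
    (AddCommGrpCat.mono_iff_injective ((quasiCoherentMap f).app S)).symm

end Embedding

section Injectives

variable {R : Type u} [Ring R]

theorem bijective_hom_app_comp_homModuleEval (N : ModuleCat.{u} R) (E : AddCommGrpCat.{u})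
    [Injective E] (G : DirectLimitFunctor R) :
    Function.Bijective fun g : G ⟶ (quasiCoherentEmbedding R).obj (homModule N E) =>
      (g.hom.hom.app N ≫ homModuleEval N E : G.obj.obj.obj N ⟶ E) :=
  (bijective_app_comp_homModuleEval N E G.obj.obj).comp
    ((PreservesDirectLimits R).fullyFaithfulι.homEquiv.trans
      (ObjectProperty.fullyFaithfulι _).homEquiv).bijective

instance injective_homModule (N : ModuleCat.{u} R) (E : AddCommGrpCat.{u}) [Injective E] :
    Injective ((quasiCoherentEmbedding R).obj (homModule N E)) where
  factors {X Y} α i _ := by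
    have := (mono_iff_mono_app i).1 inferInstance N
    obtain ⟨g, hg⟩ := (bijective_hom_app_comp_homModuleEval N E Y).2
      (Injective.factorThru (α.hom.hom.app N ≫ homModuleEval N E) (i.hom.hom.app N))
    refine ⟨g, (bijective_hom_app_comp_homModuleEval N E X).1 ?_⟩
    calc (i ≫ g).hom.hom.app N ≫ homModuleEval N E
        = i.hom.hom.app N ≫ g.hom.hom.app N ≫ homModuleEval N E := Category.assoc _ _ _
      _ = α.hom.hom.app N ≫ homModuleEval N E :=
        (congrArg (i.hom.hom.app N ≫ ·) hg).trans (Injective.comp_factorThru _ _)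

theorem exists_mono_injective (F : DirectLimitFunctor R) :
    ∃ (P : ModuleCat.{u} Rᵐᵒᵖ) (i : F ⟶ (quasiCoherentEmbedding R).obj P),
      Mono i ∧ Injective ((quasiCoherentEmbedding R).obj P) := by
  obtain ⟨N, mono_of_app⟩ := exists_forall_mono_of_mono_app R
  obtain ⟨i, hi⟩ := (bijective_hom_app_comp_homModuleEval N
    (Injective.under (F.obj.obj.obj N)) F).2 (Injective.ι _)
  exact ⟨_, i, mono_of_app i (mono_of_mono_fac hi), inferInstance⟩

theorem mem_essImage_of_injective (F : DirectLimitFunctor R) [Injective F] :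
    (quasiCoherentEmbedding R).essImage F := by
  obtain ⟨P, i, _, _⟩ := exists_mono_injective F
  exact ObjectProperty.prop_of_retract _
    { i := i, r := Injective.factorThru (𝟙 F) i } ((quasiCoherentEmbedding R).obj_mem_essImage P)

theorem isPureInjective_iff_injective {M : ModuleCat.{u} Rᵐᵒᵖ} :
    IsPureInjective M ↔ Injective ((quasiCoherentEmbedding R).obj M) := by
  constructor
  · intro hM
    obtain ⟨P, i, _, _⟩ := exists_mono_injective ((quasiCoherentEmbedding R).obj M)
    obtain ⟨f, rfl⟩ := (quasiCoherentEmbedding R).map_surjective i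
    obtain ⟨r, hr⟩ := hM f ((isPure_iff_mono f).2 inferInstance) (𝟙 M)
    exact (Retract.map { i := f, r := r, retract := hr } (quasiCoherentEmbedding R)).injective
  · intro _ N N' f hf h
    have := (isPure_iff_mono f).1 hf
    obtain ⟨g, hg⟩ := (quasiCoherentEmbedding R).map_surjective
      (Injective.factorThru ((quasiCoherentEmbedding R).map h) ((quasiCoherentEmbedding R).map f))
    exact ⟨g, (quasiCoherentEmbedding R).map_injective (by simp [hg])⟩

end Injectives

end QsCh

end

theorem mainTheorem10 {R : Type u} [Ring R] (F : QsCh.FunctorModule R) :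
    (∃ hF : QsCh.PreservesDirectLimits R F,
        CategoryTheory.Injective (⟨F, hF⟩ : QsCh.DirectLimitFunctor R)) ↔
      ∃ M : ModuleCat.{u} Rᵐᵒᵖ, QsCh.IsPureInjective M ∧
        Nonempty (F ≅ QsCh.quasiCoherent M) := by
  constructor
  · rintro ⟨hF, _⟩
    obtain ⟨M, ⟨e⟩⟩ := QsCh.mem_essImage_of_injective (⟨F, hF⟩ : QsCh.DirectLimitFunctor R)
    exact ⟨M, QsCh.isPureInjective_iff_injective.2 (Injective.of_iso e.symm inferInstance),
      ⟨(QsCh.PreservesDirectLimits R).ι.mapIso e.symm⟩⟩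
  · rintro ⟨M, hM, ⟨e⟩⟩
    have hF : QsCh.PreservesDirectLimits R F :=
      (QsCh.PreservesDirectLimits R).prop_of_iso e.symm (QsCh.quasiCoherent_preservesDirectLimits M)
    have := QsCh.isPureInjective_iff_injective.1 hM
    exact ⟨hF, Injective.of_iso ((QsCh.PreservesDirectLimits R).isoMk e.symm :
      (QsCh.quasiCoherentEmbedding R).obj M ≅ ⟨F, hF⟩) this⟩
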